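/- Let $d\ge 0$ and let $(\Omega,P)$ be a probability space on which $\mathbb{Z}^d$ acts by measurable, $P$-preserving maps $\{\tau_z\}_{z\in\mathbb{Z}^d}$; assume that the action is ergodic. Let $\Lambda=\{d_1,\dots,d_N\}\subset\mathbb{Z}^d$ be finite (the $d_i$ distinct, in any order). For every $\omega\in\Omega$ let $p(\omega)=(p_{xy}(\omega))_{x,y\in\mathbb{Z}^d}$ be a non-negative matrix, measurable in $\omega$, such that for all $\omega$, $x$, $y$, $z$: * $\sum_{y'}p_{xy'}(\omega)=1$ and $\sum_{x'}p_{x'y}(\omega)=1$ (bistochasticity); * $p_{xy}(\omega)=0$ if $y-x\notin\Lambda$ (finite range); * $\sum_{y'}(y'-x)\,p_{xy'}(\omega)=0$ (zero local drift); * $p_{xy}(\tau_z\omega)=p_{x+z,\,y+z}(\omega)$. Assume that $p$ is almost surely irreducible: for $P$-a.e. $\omega$ and every $y\in\mathbb{Z}^d$ there is $n\ge1$ such that the $n$-step transition probability $p^{(n)}_{0y}(\omega)$ is positive. Point-of-view-of-the-particle system. Let $I=[0,1)$ with Lebesgue measure $m$, and $\mu=m\times P$ on $I\times\Omega$. Put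 $q_i(\omega)=p_{0d_i}(\omega)$, $a_0=0$, $a_i=a_{i-1}+q_i$, $I_i=[a_{i-1},a_i)$. These intervals partition $I$; let $i(s,\omega)$ be the unique $i$ with $s\in I_i(\omega)$. Define $$D(s,\omega)=d_{i(s,\omega)},\qquad \phi(s,\omega)=\frac{s-a_{i(s,\omega)-1}(\omega)}{q_{i(s,\omega)}(\omega)},\qquad T(s,\omega)=\bigl(\phi(s,\omega),\tau_{D(s,\omega)}\omega\bigr),$$ and $X_n=\sum_{k=0}^{n-1}D\circ T^k$. Annealed walk. For $\omega\in\Omega$ let $P_\omega$ be the law on $(\mathbb{Z}^d)^{\mathbb{N}}$ of the Markov chain started at $0$ with transition probabilities $p(\omega)$, and let $\mathbb{P}$ be the annealed law on $\Omega\times(\mathbb{Z}^d)^{\mathbb{N}}$, given by $\mathbb{P}(B\times E)=\int_B P_\omega(E)\,P(d\omega)$. **Theorem (annealed Central Limit Theorem).** The functions $D^{(\alpha)}D^{(\beta)}$ are $\mu$-integrable, the matrix $C=(c_{\alpha\beta})_{\alpha,\beta=1}^d$ with $$c_{\alpha\beta}=\int_{I\times\Omega}D^{(\alpha)}D^{(\beta)}\,d\mu$$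 is positive semidefinite, and $X_n/\sqrt n$ converges in distribution under $\mu$, as $n\to\infty$, to the (possibly degenerate) centered Gaussian law $N(0,C)$ on $\mathbb{R}^d$. Likewise, the $n$-th position of the walk, divided by $\sqrt n$, converges in distribution to $N(0,C)$ under the annealed law $\mathbb{P}$. -/

import Mathlib

open MeasureTheory ProbabilityTheory Filter Topology

noncomputable section

namespace BistochasticRWRE

/-- The lattice `ℤ^d`. -/
abbrev Zd (d : ℕ) : Type := Fin d → ℤ

/-- The inclusion `ℤ^d ⊂ ℝ^d`. -/
def toEuclid {d : ℕ} (x : Zd d) : EuclideanSpace ℝ (Fin d) :=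
  WithLp.toLp 2 (fun α => (x α : ℝ))

/-- A bistochastic, finite-range environment on `ℤ^d` with zero local drift. The group `ℤ^d` acts
on `Ω` (the action `τ_z ω` is written `z +ᵥ ω`), and `p ω x y` is the probability to jump from `x`
to `y` in the environment `ω`. -/
structure Environment (d : ℕ) (Ω : Type*) [MeasurableSpace Ω] [AddAction (Zd d) Ω] where
  /-- the transition probabilities -/
  p : Ω → Zd d → Zd d → ℝ
  /-- the finite set of allowed jumps -/
  Λ : Finset (Zd d)
  measurable_p : ∀ x y, Measurable fun ω => p ω x y
  nonneg : ∀ ω x y, 0 ≤ p ω x y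
  /-- normalization -/
  hasSum_row : ∀ ω x, HasSum (fun y => p ω x y) 1
  /-- bistochasticity -/
  hasSum_col : ∀ ω y, HasSum (fun x => p ω x y) 1
  /-- finite range -/
  finite_range : ∀ ω x y, y - x ∉ Λ → p ω x y = 0
  /-- zero local drift -/
  zero_drift : ∀ ω x, HasSum (fun y => p ω x y • toEuclid (y - x)) 0
  /-- the group acts by translating the environment -/
  equivariant : ∀ ω z x y, p (z +ᵥ ω) x y = p ω (x + z) (y + z)

/-- The unit interval `I = [0,1)`. -/
abbrev UnitIco : Type := Set.Ico (0 : ℝ) 1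

/-- Lebesgue measure on `I = [0,1)`. -/
def lebesgueI : Measure UnitIco := Measure.comap Subtype.val (volume : Measure ℝ)

instance : IsProbabilityMeasure lebesgueI := ⟨by
  rw [lebesgueI, (MeasurableEmbedding.subtype_coe measurableSet_Ico).comap_apply,
    Set.image_univ, Subtype.range_coe_subtype]
  change volume (Set.Ico (0 : ℝ) 1) = 1
  simp⟩

namespace Environment

variable {d : ℕ} {Ω : Type*} [MeasurableSpace Ω] [AddAction (Zd d) Ω] (env : Environment d Ω)

/-- The `n`-step transition probabilities `p^{(n)}_{xy}`. -/
def nStep (ω : Ω) : ℕ → Zd d → Zd d → ℝ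
  | 0 => fun x y => if x = y then 1 else 0
  | n + 1 => fun x y => ∑' z, env.p ω x z * nStep ω n z y

/-- Almost sure irreducibility: for a.e. environment, every site can be reached from `0`. -/
def AlmostSurelyIrreducible (P : Measure Ω) : Prop :=
  ∀ᵐ ω ∂P, ∀ y : Zd d, ∃ n : ℕ, 1 ≤ n ∧ 0 < env.nStep ω n 0 y

/-! ### The walk and its annealed law -/

/-- The law `p_{x·}(ω)` of one jump of the walk from `x`. -/
def stepPMF (ω : Ω) (x : Zd d) : PMF (Zd d) :=
  ⟨fun y => ENNReal.ofReal (env.p ω x y), by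
    have h := env.hasSum_row ω x
    have h2 := ENNReal.ofReal_tsum_of_nonneg (env.nonneg ω x) h.summable
    rw [h.tsum_eq, ENNReal.ofReal_one] at h2
    rw [h2]
    exact ENNReal.summable.hasSum⟩

/-- The transition kernel on `ℤ^d` of the Markov chain in the environment `ω`. -/
def stepKernel (ω : Ω) : Kernel (Zd d) (Zd d) :=
  Kernel.ofFunOfCountable fun x => (env.stepPMF ω x).toMeasure

instance (ω : Ω) : IsMarkovKernel (env.stepKernel ω) :=
  ⟨fun x => by
    change IsProbabilityMeasure (env.stepPMF ω x).toMeasure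
    infer_instance⟩

/-- The law `P_ω` on `(ℤ^d)^ℕ` of the Markov chain started at `0` with transition probabilities
`p(ω)`. -/
def quenched (ω : Ω) : Measure (ℕ → Zd d) :=
  Kernel.trajMeasure (X := fun _ => Zd d) (Measure.dirac 0)
    (fun n => (env.stepKernel ω).comap (fun h => h ⟨n, by simp⟩) (by fun_prop))

instance (ω : Ω) : IsProbabilityMeasure (env.quenched ω) := by
  unfold quenched; infer_instance

theorem quenched_map_zero (ω ω' : Ω) :
    (env.quenched ω).map (Preorder.frestrictLe 0) =
      (env.quenched ω').map (Preorder.frestrictLe (π := fun _ => Zd d) 0) := by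
  simp only [quenched, Kernel.trajMeasure]
  rw [Measure.map_comp _ _ (by fun_prop), Measure.map_comp _ _ (by fun_prop),
    Kernel.traj_map_frestrictLe, Kernel.traj_map_frestrictLe, Kernel.partialTraj_self,
    Kernel.partialTraj_self]

theorem measurable_quenched_map (n : ℕ) : Measurable fun ω =>
    (env.quenched ω).map (Preorder.frestrictLe (π := fun _ => Zd d) n) := by
  induction n with
  | zero =>
    rcases isEmpty_or_nonempty Ω with h | ⟨⟨ω₀⟩⟩
    · exact measurable_of_empty _
    · simp_rw [fun ω => env.quenched_map_zero ω ω₀]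
      exact measurable_const
  | succ n ih =>
    have key : Measurable fun ω => (env.quenched ω).map
        (fun x : ℕ → Zd d => (Preorder.frestrictLe (π := fun _ => Zd d) n x, x (n + 1))) := by
      simp only [quenched] at ih ⊢
      simp_rw [← Kernel.map_frestrictLe_trajMeasure_compProd_eq_map_trajMeasure]
      refine Measure.measurable_of_measurable_coe _ fun s hs => ?_
      simp_rw [Measure.compProd_apply hs, lintegral_countable']
      refine Measurable.tsum fun h => Measurable.mul ?_
        (Measure.measurable_coe (measurableSet_singleton h) |>.comp ih)
      simp only [Kernel.comap_apply, stepKernel]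
      change Measurable fun ω => (env.stepPMF ω _).toMeasure _
      simp_rw [PMF.toMeasure_apply _ (measurable_prodMk_left hs)]
      refine Measurable.tsum fun y => ?_
      by_cases hy : y ∈ Prod.mk h ⁻¹' s
      · simp only [Set.indicator_of_mem hy]
        exact (env.measurable_p _ _).ennreal_ofReal
      · simp only [Set.indicator_of_notMem hy]
        exact measurable_const
    let g : (Finset.Iic n → Zd d) × Zd d → (Finset.Iic (n + 1) → Zd d) :=
      fun x i => if h : i.val ≤ n then x.1 ⟨i.val, Finset.mem_Iic.2 h⟩ else x.2
    have hg : Measurable g := .of_discrete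
    have h2 : ∀ ω, (env.quenched ω).map (Preorder.frestrictLe (π := fun _ => Zd d) (n + 1)) =
        ((env.quenched ω).map (fun x : ℕ → Zd d =>
          (Preorder.frestrictLe (π := fun _ => Zd d) n x, x (n + 1)))).map g := by
      intro ω
      rw [Measure.map_map hg (by fun_prop)]
      congr 1
      funext x i
      by_cases h : i.val ≤ n
      · simp [g, h]
      · have hi : i.val = n + 1 := le_antisymm (Finset.mem_Iic.1 i.2) (by omega)
        simp [g, hi]
    simp_rw [h2]
    exact (Measure.measurable_map g hg).comp key

theorem measurable_quenched : Measurable env.quenched := by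
  refine Measurable.measure_of_isPiSystem_of_isProbabilityMeasure
    (generateFrom_measurableCylinders (α := fun _ : ℕ => Zd d)).symm
    isPiSystem_measurableCylinders fun t ht => ?_
  obtain ⟨s, S, hS, rfl⟩ := (mem_measurableCylinders t).1 ht
  have hs : s ⊆ Finset.Iic (s.sup id) := fun i hi => Finset.mem_Iic.2 (Finset.le_sup (f := id) hi)
  have h2 : MeasurableSet (Finset.restrict₂ (π := fun _ : ℕ => Zd d) hs ⁻¹' S) := .of_discrete
  convert (Measure.measurable_coe h2).comp (env.measurable_quenched_map (s.sup id)) using 1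
  funext ω
  exact (Measure.map_apply
    (Preorder.measurable_frestrictLe (X := fun _ : ℕ => Zd d) (s.sup id)) h2).symm

/-- `ω ↦ P_ω` as a kernel. -/
def quenchedKernel : Kernel Ω (ℕ → Zd d) := ⟨env.quenched, env.measurable_quenched⟩

instance : IsMarkovKernel env.quenchedKernel :=
  ⟨fun ω => by change IsProbabilityMeasure (env.quenched ω); infer_instance⟩

/-- The annealed law on `Ω × (ℤ^d)^ℕ`, i.e. `ℙ(B × E) = ∫_B P_ω(E) P(dω)`. -/
def annealed (P : Measure Ω) : Measure (Ω × (ℕ → Zd d)) := P ⊗ₘ env.quenchedKernel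

instance (P : Measure Ω) [IsProbabilityMeasure P] : IsProbabilityMeasure (env.annealed P) := by
  unfold annealed; infer_instance

theorem annealed_prod (P : Measure Ω) [IsProbabilityMeasure P] {B : Set Ω} {E : Set (ℕ → Zd d)}
    (hB : MeasurableSet B) (hE : MeasurableSet E) :
    env.annealed P (B ×ˢ E) = ∫⁻ ω in B, env.quenched ω E ∂P :=
  Measure.compProd_apply_prod hB hE

/-! ### The point-of-view-of-the-particle dynamical system

Below `e` is an enumeration `d_0, …, d_{N-1}` of `Λ`. -/

variable (e : Fin env.Λ.card ≃ env.Λ)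

/-- `q_i(ω) = p_{0 d_i}(ω)`. -/
def q (ω : Ω) (i : Fin env.Λ.card) : ℝ := env.p ω 0 (e i)

/-- The partial sums `a_k = ∑_{j < k} q_j` (there are `k` summands). -/
def cut (ω : Ω) (k : ℕ) : ℝ := ∑ j with j.val < k, env.q e ω j

/-- The interval `I_i(ω)` between two consecutive partial sums; its length is `q_i(ω)`. -/
def interval (ω : Ω) (i : Fin env.Λ.card) : Set ℝ :=
  Set.Ico (env.cut e ω i.val) (env.cut e ω (i.val + 1))

theorem cut_zero (ω : Ω) : env.cut e ω 0 = 0 := by simp [cut]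

theorem cut_succ (ω : Ω) (i : Fin env.Λ.card) :
    env.cut e ω (i.val + 1) = env.cut e ω i.val + env.q e ω i := by
  have h : (Finset.univ.filter fun j : Fin env.Λ.card => j.val < i.val + 1) =
      insert i (Finset.univ.filter fun j : Fin env.Λ.card => j.val < i.val) := by
    ext j
    simp only [Finset.mem_filter, Finset.mem_univ, true_and, Finset.mem_insert, Fin.ext_iff]
    omega
  rw [cut, h, Finset.sum_insert (by simp), cut, add_comm]

theorem cut_mono (ω : Ω) : Monotone (env.cut e ω) := fun k l hkl =>
  Finset.sum_le_sum_of_subset_of_nonneg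
    (fun j hj => by
      simp only [Finset.mem_filter, Finset.mem_univ, true_and] at hj ⊢
      omega)
    (fun _ _ _ => env.nonneg _ _ _)

theorem sum_q (ω : Ω) : ∑ i, env.q e ω i = 1 := by
  have h1 : HasSum (fun y => env.p ω 0 y) (∑ y ∈ env.Λ, env.p ω 0 y) :=
    hasSum_sum_of_ne_finset_zero fun y hy => env.finite_range ω 0 y (by simpa using hy)
  rw [← h1.unique (env.hasSum_row ω 0), ← Finset.sum_coe_sort env.Λ]
  exact Equiv.sum_comp e (fun y : env.Λ => env.p ω 0 y)

theorem cut_card (ω : Ω) : env.cut e ω env.Λ.card = 1 := by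
  simp [cut, sum_q]

theorem existsUnique_index (ω : Ω) (s : UnitIco) :
    ∃! i : Fin env.Λ.card, s.val ∈ env.interval e ω i := by
  have hex : ∃ k, s.val < env.cut e ω k := ⟨env.Λ.card, by rw [cut_card]; exact s.2.2⟩
  classical
  obtain ⟨k, hk, hmin⟩ : ∃ k, s.val < env.cut e ω k ∧ ∀ m < k, env.cut e ω m ≤ s.val :=
    ⟨Nat.find hex, Nat.find_spec hex, fun m hm => not_lt.1 (Nat.find_min hex hm)⟩
  have hk0 : k ≠ 0 := by
    rintro rfl
    rw [cut_zero] at hk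
    exact absurd s.2.1 (not_le.2 hk)
  obtain ⟨m, rfl⟩ := Nat.exists_eq_succ_of_ne_zero hk0
  have hm : m < env.Λ.card := by
    by_contra hcon
    have h := (env.cut_mono e ω (not_lt.1 hcon)).trans (hmin m (Nat.lt_succ_self m))
    rw [cut_card] at h
    exact absurd s.2.2 (not_lt.2 h)
  refine ⟨⟨m, hm⟩, ⟨hmin m (Nat.lt_succ_self m), hk⟩, ?_⟩
  rintro j ⟨hj1, hj2⟩
  rcases lt_trichotomy j.val m with h | h | h
  · exact absurd ((env.cut_mono e ω (Nat.succ_le_of_lt h)).trans (hmin m (Nat.lt_succ_self m)))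
      (not_le.2 hj2)
  · exact Fin.ext h
  · exact absurd ((env.cut_mono e ω (Nat.succ_le_of_lt h)).trans hj1) (not_le.2 hk)

/-- `i(s,ω)`: the unique `i` with `s ∈ I_i(ω)`. -/
def index (s : UnitIco) (ω : Ω) : Fin env.Λ.card := (env.existsUnique_index e ω s).choose

theorem index_spec (s : UnitIco) (ω : Ω) : s.val ∈ env.interval e ω (env.index e s ω) :=
  (env.existsUnique_index e ω s).choose_spec.1

/-- The displacement function `D(s,ω) = d_{i(s,ω)}`. -/
def displacement (x : UnitIco × Ω) : Zd d := e (env.index e x.1 x.2)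

/-- The internal dynamics `φ(s,ω)`: on `I_i(ω)` it is the increasing affine bijection onto
`[0,1)`. -/
def phi (x : UnitIco × Ω) : UnitIco :=
  ⟨(env.q e x.2 (env.index e x.1 x.2))⁻¹ *
      (x.1.val - env.cut e x.2 (env.index e x.1 x.2).val), by
    obtain ⟨h1, h2⟩ := env.index_spec e x.1 x.2
    rw [cut_succ] at h2
    have hq : 0 < env.q e x.2 (env.index e x.1 x.2) := by linarith
    rw [inv_mul_eq_div]
    exact ⟨div_nonneg (by linarith) hq.le, (div_lt_one hq).2 (by linarith)⟩⟩

/-- The skew product `T(s,ω) = (φ(s,ω), τ_{D(s,ω)} ω)`. -/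
def povMap (x : UnitIco × Ω) : UnitIco × Ω := (env.phi e x, env.displacement e x +ᵥ x.2)

/-- The walk `X_n = ∑_{k<n} D ∘ T^k` on the point-of-view-of-the-particle system. -/
def walk (n : ℕ) (x : UnitIco × Ω) : Zd d :=
  ∑ k ∈ Finset.range n, env.displacement e ((env.povMap e)^[k] x)

end Environment

/-- The measure `μ = m × P` on `I × Ω`. -/
def povMeasure {Ω : Type*} [MeasurableSpace Ω] (P : Measure Ω) : Measure (UnitIco × Ω) :=
  lebesgueI.prod P

instance {Ω : Type*} [MeasurableSpace Ω] (P : Measure Ω) [IsProbabilityMeasure P] :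
    IsProbabilityMeasure (povMeasure P) := by
  unfold povMeasure; infer_instance

/-- The matrix `c_{αβ} = ∫ D^{(α)} D^{(β)} dμ`. -/
def Environment.covMatrix {d : ℕ} {Ω : Type*} [MeasurableSpace Ω] [AddAction (Zd d) Ω]
    (env : Environment d Ω) (e : Fin env.Λ.card ≃ env.Λ) (P : Measure Ω) :
    Matrix (Fin d) (Fin d) ℝ :=
  fun α β => ∫ x, (env.displacement e x α : ℝ) * (env.displacement e x β : ℝ) ∂(povMeasure P)

/-- The `ℤ^d`-valued process `X` satisfies the central limit theorem with mean zero and covariance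
matrix `C` (possibly degenerate): `X_n / √n` converges in distribution to `N(0, C)`. -/
def SatisfiesCLT {d : ℕ} {S : Type*} [MeasurableSpace S] (X : ℕ → S → Zd d) (μ : Measure S)
    [IsProbabilityMeasure μ] (C : Matrix (Fin d) (Fin d) ℝ) : Prop :=
  C.PosSemidef ∧
    TendstoInDistribution (fun (n : ℕ) s => (√(n : ℝ))⁻¹ • toEuclid (X n s)) atTop id
      (fun _ => μ) (multivariateGaussian 0 C)

end BistochasticRWRE

end

open BistochasticRWRE

/-! ### Powers of contractions close to the identity on a vector, and the Taylor bound. -/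

namespace BistochasticRWRE

/-! The proof is a perturbation argument for characteristic functions in `L²(P)`. For fixed `t`, let
`R_n f (ω) = ∑_y exp(i⟨y,t⟩/√n) p_{0y}(ω) f(τ_y ω)`. Conditioning on successive jumps shows that the
characteristic function of the rescaled position at time `n` is `∫ R_n^n 1 dP`, both on the
point-of-view system (`integral_povMeasure_walk`) and under the annealed law (`integral_annealed`).
One limit therefore gives both theorems.

Expanding the exponential, zero drift kills the term of order `1/√n`, so `R_n 1 = 1 - b/n + o(1/n)`
with `b = ∑_y (⟨y,t⟩²/2) p_{0y}`, a function of the environment. Let `c = ∫ b dP = ⟨t, C t⟩/2`. If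
`b - c = g - Q g`, where `Q` is the untwisted operator, then `f = 1 - g/n` satisfies `R_n f = (1 -
c/n) f + o(1/n)`. As `R_n` is a contraction, `n` iterations accumulate only an `o(1)` error, and
`R_n^n 1 → exp(-c)`. It is enough to solve the equation for `g` approximately in norm
(`tendsto_pow_apply_of_mem_closure_range`).

Approximate solvability is where bistochasticity, ergodicity and irreducibility enter.
Bistochasticity makes `P` stationary for the environment seen from the particle, so `Q` and all
`R_n` are contractions of `L²(P)`. Irreducibility and ergodicity of the action leave only constants
fixed by `Q`. Hence every mean-zero vector lies in the closure of the range of `1 - Q`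
(`mem_closure_range_sub_twistedOp`). Lévy's continuity theorem concludes. -/

theorem norm_pow_apply_sub_pow_smul_le {E : Type*} [NormedAddCommGroup E] [NormedSpace ℂ E]
    (R : E →L[ℂ] E) (hR : ∀ f, ‖R f‖ ≤ ‖f‖) {l : ℂ} (hl : ‖l‖ ≤ 1) (f : E) (m : ℕ) :
    ‖(R ^ m) f - l ^ m • f‖ ≤ m * ‖R f - l • f‖ := by
  induction m with
  | zero => simp
  | succ m ih =>
    -- Telescoping: since `R` is a contraction and `‖l‖ ≤ 1`, each further power adds at most one
    -- copy of the defect `‖R f - l • f‖`.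
    have h : (R ^ (m + 1)) f - l ^ (m + 1) • f
        = R ((R ^ m) f - l ^ m • f) + l ^ m • (R f - l • f) := by
      rw [pow_succ', mul_apply_eq_comp, map_sub, map_smul, smul_sub, smul_smul,
        ← pow_succ]
      abel
    rw [h]
    calc _ ≤ ‖(R ^ m) f - l ^ m • f‖ + 1 * ‖R f - l • f‖ := by
          refine (norm_add_le _ _).trans (add_le_add (hR _) ?_)
          rw [norm_smul, norm_pow]
          gcongr
          exact pow_le_one₀ (norm_nonneg _) hl
      _ ≤ m * ‖R f - l • f‖ + 1 * ‖R f - l • f‖ := by gcongr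
      _ = _ := by push_cast; ring

theorem norm_pow_apply_le {E : Type*} [NormedAddCommGroup E] [NormedSpace ℂ E]
    (R : E →L[ℂ] E) (hR : ∀ f, ‖R f‖ ≤ ‖f‖) (f : E) (m : ℕ) : ‖(R ^ m) f‖ ≤ ‖f‖ := by
  induction m with
  | zero => simp
  | succ m ih =>
    rw [pow_succ', mul_apply_eq_comp]
    exact (hR _).trans ih

/-- Powers of contractions `R n = 1 - O(1/n)` applied to a vector `u` which is an approximate
eigenvector up to a coboundary of the limit operator. -/
theorem tendsto_pow_apply_of_mem_closure_range {E : Type*} [NormedAddCommGroup E]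
    [NormedSpace ℂ E] (Q : E →L[ℂ] E) (R : ℕ → E →L[ℂ] E) (hR : ∀ n f, ‖R n f‖ ≤ ‖f‖)
    (hRQ : ∀ g, Tendsto (fun n => R n g) atTop (𝓝 (Q g))) (u b : E) {c : ℝ} (hc : 0 ≤ c)
    (hu : Tendsto (fun n : ℕ => (n : ℂ) • (R n u - u)) atTop (𝓝 (-b)))
    (hb : b - (c : ℂ) • u ∈ closure (Set.range fun g => g - Q g)) :
    Tendsto (fun n => (R n ^ n) u) atTop (𝓝 (Complex.exp (-c) • u)) := by
  have hl0 : Tendsto (fun n : ℕ => (1 + (-c : ℂ) / n)) atTop (𝓝 1) := by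
    simpa using (tendsto_const_div_atTop_nhds_zero_nat (-c : ℂ)).const_add 1
  have hl : Tendsto (fun n : ℕ => (1 + (-c : ℂ) / n) ^ n • u) atTop
      (𝓝 (Complex.exp (-c) • u)) :=
    (Complex.tendsto_one_add_div_pow_exp (-c)).smul_const u
  suffices h : Tendsto (fun n : ℕ => (R n ^ n) u - (1 + (-c : ℂ) / n) ^ n • u) atTop (𝓝 0) by
    simpa using h.add hl
  rw [tendsto_zero_iff_norm_tendsto_zero, Metric.tendsto_atTop']
  intro ε hε
  -- `g` solves `b - c • u = g - Q g` up to `ε / 2`; it is fixed before `n` tends to infinity.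
  obtain ⟨_, ⟨g, rfl⟩, hg⟩ := Metric.mem_closure_iff.1 hb (ε / 2) (by positivity)
  have h1 : Tendsto (fun n : ℕ => (n : ℂ) • (R n u - u) + (c : ℂ) • u - R n g
      + (1 + (-c : ℂ) / n) • g) atTop (𝓝 (-b + (c : ℂ) • u - Q g + (1 : ℂ) • g)) :=
    ((hu.add tendsto_const_nhds).sub (hRQ g)).add (hl0.smul_const g)
  have h1' : ‖-b + (c : ℂ) • u - Q g + (1 : ℂ) • g‖ < ε / 2 := by
    rw [dist_eq_norm, ← norm_neg (_ - _)] at hg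
    rwa [show -b + (c : ℂ) • u - Q g + (1 : ℂ) • g = -(b - (c : ℂ) • u - (g - Q g)) by
      rw [one_smul]; abel]
  have h2 : Tendsto (fun n : ℕ => 2 * (‖g‖ / n)) atTop (𝓝 0) := by
    simpa using (tendsto_const_div_atTop_nhds_zero_nat ‖g‖).const_mul 2
  obtain ⟨N, hN⟩ := eventually_atTop.1 ((h1.norm.eventually_lt_const h1').and
    (h2.eventually_lt_const (half_pos hε)))
  -- `n ≥ c` puts `1 - c / n` in `[0, 1]`, so that `‖l‖ ≤ 1` below.
  refine ⟨max N (max 1 ⌈c⌉₊), fun n hn => ?_⟩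
  obtain ⟨h3, h4⟩ := hN n (by omega)
  have hn1 : 1 ≤ n := by omega
  have hn0 : (n : ℂ) ≠ 0 := by exact_mod_cast (by omega : n ≠ 0)
  have hnc : c ≤ n := Nat.ceil_le.1 (by omega)
  have hnpos : (0 : ℝ) < n := by exact_mod_cast hn1
  set l : ℂ := 1 + (-c : ℂ) / n with hl_def
  have hl1 : ‖l‖ ≤ 1 := by
    have h : l = ((1 - c / n : ℝ) : ℂ) := by rw [hl_def]; push_cast; ring
    rw [h, Complex.norm_real, Real.norm_eq_abs, abs_le]
    have h5 : c / n ≤ 1 := (div_le_one hnpos).2 hnc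
    have h6 : 0 ≤ c / n := by positivity
    constructor <;> linarith
  -- The first-order corrector: `f` is an eigenvector of `R n` for `l` up to an error smaller than
  -- `ε / (2n)`.
  obtain ⟨f, hf⟩ : ∃ f : E, f = u - (n : ℂ)⁻¹ • g := ⟨_, rfl⟩
  have h5 : (n : ℂ) • (R n f - l • f) = (n : ℂ) • (R n u - u) + (c : ℂ) • u - R n g + l • g := by
    have h6 : (n : ℂ) * l = n - c := by rw [hl_def]; field_simp; ring
    have h7 : (n - c : ℂ) * (n : ℂ)⁻¹ = l := by rw [← h6]; field_simp
    simp only [hf, map_sub, map_smul, smul_sub, smul_smul, mul_inv_cancel₀ hn0, one_smul,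
      ← mul_assoc, h6, h7]
    rw [sub_smul]
    abel
  have h6 : ‖(R n ^ n) f - l ^ n • f‖ < ε / 2 := by
    refine (norm_pow_apply_sub_pow_smul_le (R n) (hR n) hl1 f n).trans_lt ?_
    rw [← h5, norm_smul, Complex.norm_natCast] at h3
    exact h3
  have h7 : ‖u - f‖ = ‖g‖ / n := by
    rw [hf, sub_sub_cancel, norm_smul, norm_inv, Complex.norm_natCast]; ring
  have h8 : (R n ^ n) u - l ^ n • u
      = ((R n ^ n) f - l ^ n • f) + ((R n ^ n) (u - f) - l ^ n • (u - f)) := by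
    rw [(R n ^ n).map_sub u f, smul_sub (l ^ n) u f]; abel
  have h9 : ‖(R n ^ n) (u - f) - l ^ n • (u - f)‖ ≤ 2 * (‖g‖ / n) := by
    rw [← h7, two_mul]
    refine (norm_sub_le _ _).trans (add_le_add (norm_pow_apply_le (R n) (hR n) _ _) ?_)
    rw [norm_smul, norm_pow]
    exact mul_le_of_le_one_left (norm_nonneg _) (pow_le_one₀ (norm_nonneg _) hl1)
  rw [Real.dist_eq, sub_zero, abs_norm, h8]
  linarith [norm_add_le ((R n ^ n) f - l ^ n • f) ((R n ^ n) (u - f) - l ^ n • (u - f))]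

/-- Second-order Taylor expansion of `exp (i x)` at scale `1 / √n`. -/
theorem tendsto_nat_mul_exp_sub_one_sub (x : ℝ) :
    Tendsto (fun n : ℕ => (n : ℂ) * (Complex.exp (((√(n : ℝ))⁻¹ * x : ℝ) * Complex.I) - 1
      - ((√(n : ℝ))⁻¹ * x : ℝ) * Complex.I)) atTop (𝓝 (-(x ^ 2 / 2 : ℝ))) := by
  have hs : Tendsto (fun n : ℕ => (√(n : ℝ))⁻¹) atTop (𝓝 0) :=
    tendsto_inv_atTop_zero.comp (Real.tendsto_sqrt_atTop.comp tendsto_natCast_atTop_atTop)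
  have h1 : Tendsto (fun n : ℕ => (√(n : ℝ))⁻¹ * |x|) atTop (𝓝 0) := by
    simpa using hs.mul_const |x|
  have h2 : Tendsto (fun n : ℕ => (√(n : ℝ))⁻¹ * |x| ^ 3) atTop (𝓝 0) := by
    simpa using hs.mul_const (|x| ^ 3)
  rw [tendsto_iff_norm_sub_tendsto_zero]
  refine squeeze_zero' (.of_forall fun _ => norm_nonneg _) ?_ h2
  filter_upwards [h1.eventually_le_const one_pos, eventually_ge_atTop 1] with n hn hn1
  have hpos : (0 : ℝ) < √(n : ℝ) := Real.sqrt_pos.2 (by exact_mod_cast hn1)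
  have hsq : √(n : ℝ) ^ 2 = n := Real.sq_sqrt (by positivity)
  set r : ℝ := (√(n : ℝ))⁻¹ with hr
  have hr2 : (n : ℝ) * r ^ 2 = 1 := by rw [← hsq, hr]; field_simp
  have hr2' : (n : ℂ) * (r : ℂ) ^ 2 = 1 := by exact_mod_cast hr2
  have hr0 : 0 ≤ r := by positivity
  set z : ℂ := ((r * x : ℝ) : ℂ) * Complex.I with hz
  have hzn : ‖z‖ = r * |x| := by
    rw [hz, norm_mul, Complex.norm_I, mul_one, Complex.norm_real, Real.norm_eq_abs, abs_mul,
      abs_of_nonneg hr0]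
  have h3 := Complex.exp_bound (x := z) (by rw [hzn]; exact hn) (n := 3) (by norm_num)
  have hz2 : z ^ 2 = -((r : ℂ) ^ 2 * (x : ℂ) ^ 2) := by
    rw [hz, mul_pow, Complex.I_sq]; push_cast; ring
  have h4 : (n : ℂ) * (Complex.exp z - 1 - z) - (-(x ^ 2 / 2 : ℝ))
      = n * (Complex.exp z - ∑ m ∈ Finset.range 3, z ^ m / m.factorial) := by
    simp only [Finset.sum_range_succ, Finset.sum_range_zero, Nat.factorial, hz2]
    push_cast
    -- The factor `n` exactly cancels the scale `r ^ 2` of the quadratic term, leaving the cubic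
    -- remainder of order `r`.
    linear_combination (-(x : ℂ) ^ 2 / 2) * hr2'
  rw [h4, norm_mul, Complex.norm_natCast]
  calc (n : ℝ) * ‖Complex.exp z - ∑ m ∈ Finset.range 3, z ^ m / m.factorial‖
      ≤ n * (‖z‖ ^ 3 * 1) := by
        gcongr
        refine h3.trans ?_
        gcongr
        norm_num [Nat.factorial]
    _ = (n * r ^ 2) * (r * |x| ^ 3) := by rw [hzn]; ring
    _ = r * |x| ^ 3 := by rw [hr2, one_mul]

end BistochasticRWRE

/-! ### The environment seen from the particle: stationarity, twisted operators, ergodicity. -/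

namespace BistochasticRWRE
namespace Environment

variable {d : ℕ} {Ω : Type*} [MeasurableSpace Ω] [AddAction (Zd d) Ω] (env : Environment d Ω)

theorem sum_row_zero (ω : Ω) : ∑ y ∈ env.Λ, env.p ω 0 y = 1 :=
  (hasSum_sum_of_ne_finset_zero fun y hy =>
    env.finite_range ω 0 y (by simpa using hy)).unique (env.hasSum_row ω 0)

theorem sum_col_zero (ω : Ω) : ∑ y ∈ env.Λ, env.p ω (-y) 0 = 1 :=
  (hasSum_sum_of_ne_finset_zero fun y hy =>
    env.finite_range ω (-y) 0 (by simpa using hy)).unique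
    ((Equiv.neg (Zd d)).hasSum_iff.2 (env.hasSum_col ω 0))

theorem p_le_one (ω : Ω) (x y : Zd d) : env.p ω x y ≤ 1 :=
  le_hasSum (env.hasSum_row ω x) y fun z _ => env.nonneg ω x z

/-- A function on sites which is constant along possible jumps is constant along possible
paths. -/
theorem eq_of_nStep_pos {ω : Ω} {X : Type*} {h : Zd d → X}
    (hh : ∀ x y, 0 < env.p ω x y → h y = h x) (n : ℕ) :
    ∀ x y, 0 < env.nStep ω n x y → h y = h x := by
  induction n with
  | zero =>
    intro x y hxy
    by_cases h1 : x = y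
    · rw [h1]
    · simp [nStep, h1] at hxy
  | succ n ih =>
    intro x y hxy
    obtain ⟨z, hz⟩ : ∃ z, env.p ω x z * env.nStep ω n z y ≠ 0 := by
      by_contra! hcon
      simp [nStep, hcon] at hxy
    have h1 : 0 < env.p ω x z :=
      (env.nonneg ω x z).lt_of_ne' (left_ne_zero_of_mul hz)
    have h2 : ∀ m a b, 0 ≤ env.nStep ω m a b := by
      intro m
      induction m with
      | zero => intro a b; simp only [nStep]; split_ifs <;> norm_num
      | succ m ih' =>
        exact fun a b => tsum_nonneg fun c => mul_nonneg (env.nonneg ω a c) (ih' c b)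
    rw [ih z y ((h2 n z y).lt_of_ne' (right_ne_zero_of_mul hz)), hh x z h1]

/-- Preimages of measurable sets are almost invariant, hence null or conull; measurable sets
separate points of `ℂ` countably, which forces a single value. -/
theorem ae_eq_const_of_forall_vadd_ae_eq (P : Measure Ω) [ErgodicVAdd (Zd d) Ω P]
    {h : Ω → ℂ} (hm : AEStronglyMeasurable h P)
    (hinv : ∀ z : Zd d, ∀ᵐ ω ∂P, h (z +ᵥ ω) = h ω) : ∃ c, h =ᵐ[P] Function.const Ω c := by
  refine exists_eventuallyEq_const_of_forall_separating MeasurableSet fun U hU => ?_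
  have h1 : EventuallyConst (h ⁻¹' U) (ae P) :=
    aeconst_of_forall_preimage_vadd_ae_eq (Zd d) (hm.aemeasurable.nullMeasurable hU) fun z =>
      ((hinv z).mono fun ω hω => by
        change ((z +ᵥ ω) ∈ h ⁻¹' U) = (ω ∈ h ⁻¹' U)
        rw [Set.mem_preimage, hω, Set.mem_preimage])
  rcases eventuallyConst_set'.1 h1 with h2 | h2
  · right
    filter_upwards [h2.mem_iff] with ω hω using by simpa using hω
  · left
    filter_upwards [h2.mem_iff] with ω hω using by simpa using hω

variable [MeasurableConstVAdd (Zd d) Ω] (P : Measure Ω)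

section Invariant

variable [VAddInvariantMeasure (Zd d) Ω P]

theorem integrable_transition {f : Ω → ℝ} (hf : Integrable f P) (y : Zd d) :
    Integrable (fun ω => env.p ω 0 y * f (y +ᵥ ω)) P :=
  ((measurePreserving_vadd y P).integrable_comp_of_integrable hf).bdd_mul (c := 1)
    (env.measurable_p 0 y).aestronglyMeasurable
    (.of_forall fun ω => by
      rw [Real.norm_eq_abs, abs_of_nonneg (env.nonneg ω 0 y)]
      exact env.p_le_one ω 0 y)

/-- Bistochasticity: `P` is invariant for the environment seen from the particle. -/
theorem integral_sum_transition {f : Ω → ℝ} (hf : Integrable f P) :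
    ∫ ω, ∑ y ∈ env.Λ, env.p ω 0 y * f (y +ᵥ ω) ∂P = ∫ ω, f ω ∂P := by
  rw [integral_finsetSum _ fun y _ => env.integrable_transition P hf y]
  -- Translating by `-y` turns a jump from `0` to `y` into a jump from `-y` to `0`; these incoming
  -- probabilities sum to `1`.
  have h1 : ∀ y : Zd d, ∫ ω, env.p ω 0 y * f (y +ᵥ ω) ∂P = ∫ ω, env.p ω (-y) 0 * f ω ∂P := by
    intro y
    rw [← (measurePreserving_vadd (-y) P).integral_comp (measurableEmbedding_const_vadd (-y))]
    refine integral_congr_ae (.of_forall fun ω => ?_)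
    simp [env.equivariant]
  simp_rw [h1]
  rw [← integral_finsetSum]
  · simp_rw [← Finset.sum_mul, env.sum_col_zero, one_mul]
  · intro y _
    have h := (measurePreserving_vadd (-y) P).integrable_comp_of_integrable
      (env.integrable_transition P hf y)
    refine h.congr (.of_forall fun ω => ?_)
    simp [env.equivariant]

theorem memLp_jump (y : Zd d) {f : Ω → ℂ} (hf : MemLp f 2 P) :
    MemLp (fun ω => (env.p ω 0 y : ℂ) * f (y +ᵥ ω)) 2 P := by
  have h := hf.comp_measurePreserving (measurePreserving_vadd y P)
  refine h.of_le ((Complex.measurable_ofReal.comp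
    (env.measurable_p 0 y)).aestronglyMeasurable.mul h.1) (.of_forall fun ω => ?_)
  rw [norm_mul, Complex.norm_real, Real.norm_eq_abs, abs_of_nonneg (env.nonneg ω 0 y)]
  exact mul_le_of_le_one_left (norm_nonneg _) (env.p_le_one ω 0 y)

/-- The operator `f ↦ (ω ↦ p_{0y}(ω) f(τ_y ω))` on `L²(P)`. -/
noncomputable def jumpOp (y : Zd d) : Lp ℂ 2 P →L[ℂ] Lp ℂ 2 P :=
  LinearMap.mkContinuous
    { toFun := fun f => (env.memLp_jump P y (Lp.memLp f)).toLp _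
      map_add' := fun f g => by
        rw [← MemLp.toLp_add, MemLp.toLp_eq_toLp_iff]
        filter_upwards [(measurePreserving_vadd y P).quasiMeasurePreserving.ae
          (Lp.coeFn_add f g)] with ω h
        rw [Pi.add_apply, h, Pi.add_apply, mul_add]
      map_smul' := fun c f => by
        rw [RingHom.id_apply, ← MemLp.toLp_const_smul, MemLp.toLp_eq_toLp_iff]
        filter_upwards [(measurePreserving_vadd y P).quasiMeasurePreserving.ae
          (Lp.coeFn_smul c f)] with ω h
        rw [Pi.smul_apply, h, Pi.smul_apply, smul_eq_mul, smul_eq_mul, mul_left_comm] } 1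
    fun f => by
      rw [one_mul, ← Lp.norm_compMeasurePreserving f (measurePreserving_vadd y P)]
      refine Lp.norm_le_norm_of_ae_le ?_
      filter_upwards [MemLp.coeFn_toLp (env.memLp_jump P y (Lp.memLp f)),
        Lp.coeFn_compMeasurePreserving f (measurePreserving_vadd y P)] with ω h1 h2
      change ‖(env.memLp_jump P y (Lp.memLp f)).toLp _ ω‖ ≤ _
      rw [h1, h2, norm_mul, Complex.norm_real, Real.norm_eq_abs, abs_of_nonneg (env.nonneg ω 0 y)]
      exact mul_le_of_le_one_left (norm_nonneg _) (env.p_le_one ω 0 y)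

theorem coeFn_jumpOp (y : Zd d) (f : Lp ℂ 2 P) :
    env.jumpOp P y f =ᵐ[P] fun ω => (env.p ω 0 y : ℂ) * f (y +ᵥ ω) :=
  MemLp.coeFn_toLp (env.memLp_jump P y (Lp.memLp f))

/-- The transition operator twisted by the weight `w` on the jumps. -/
noncomputable def twistedOp (w : Zd d → ℂ) : Lp ℂ 2 P →L[ℂ] Lp ℂ 2 P :=
  ∑ y ∈ env.Λ, w y • env.jumpOp P y

theorem twistedOp_apply (w : Zd d → ℂ) (f : Lp ℂ 2 P) :
    env.twistedOp P w f = ∑ y ∈ env.Λ, w y • env.jumpOp P y f := by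
  simp [twistedOp]

theorem coeFn_sum_smul_jumpOp (w : Zd d → ℂ) (f : Lp ℂ 2 P) :
    (∑ y ∈ env.Λ, w y • env.jumpOp P y f : Lp ℂ 2 P) =ᵐ[P]
      fun ω => ∑ y ∈ env.Λ, w y * (env.p ω 0 y * f (y +ᵥ ω)) := by
  have h : ∀ y : Zd d, (w y • env.jumpOp P y f : Lp ℂ 2 P) =ᵐ[P]
      fun ω => w y * (env.p ω 0 y * f (y +ᵥ ω)) := fun y => by
    filter_upwards [Lp.coeFn_smul (w y) (env.jumpOp P y f), env.coeFn_jumpOp P y f] with ω h1 h2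
    rw [h1, Pi.smul_apply, h2, smul_eq_mul]
  have h3 := (ae_all_iff (μ := P)).2 h
  filter_upwards [Lp.coeFn_finsetSum env.Λ fun y => w y • env.jumpOp P y f, h3] with ω h1 h2
  rw [h1, Finset.sum_apply]
  exact Finset.sum_congr rfl fun y _ => h2 y

theorem coeFn_twistedOp (w : Zd d → ℂ) (f : Lp ℂ 2 P) :
    env.twistedOp P w f =ᵐ[P] fun ω => ∑ y ∈ env.Λ, w y * (env.p ω 0 y * f (y +ᵥ ω)) := by
  rw [twistedOp_apply]
  exact env.coeFn_sum_smul_jumpOp P w f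

theorem norm_sq_eq_integral (f : Lp ℂ 2 P) : ‖f‖ ^ 2 = ∫ ω, ‖f ω‖ ^ 2 ∂P := by
  have h : ((‖f‖ ^ 2 : ℝ) : ℂ) = ((∫ ω, ‖f ω‖ ^ 2 ∂P : ℝ) : ℂ) := by
    rw [← integral_complex_ofReal]
    rw [Complex.ofReal_pow]
    refine (inner_self_eq_norm_sq_to_K (𝕜 := ℂ) f).symm.trans ?_
    rw [L2.inner_def]
    refine integral_congr_ae (.of_forall fun ω => ?_)
    simp only [inner_self_eq_norm_sq_to_K, Complex.ofReal_pow]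
    rfl
  exact_mod_cast h

theorem integrable_norm_sq (f : Lp ℂ 2 P) : Integrable (fun ω => ‖f ω‖ ^ 2) P :=
  (memLp_two_iff_integrable_sq_norm (Lp.aestronglyMeasurable f)).1 (Lp.memLp f)

/-- Jensen's inequality for the probability weights `p_{0y}(ω)` bounds the square pointwise, and
stationarity of `P` integrates the bound to `‖f‖ ^ 2`. -/
theorem norm_twistedOp_le {w : Zd d → ℂ} (hw : ∀ y, ‖w y‖ ≤ 1) (f : Lp ℂ 2 P) :
    ‖env.twistedOp P w f‖ ≤ ‖f‖ := by
  refine (pow_le_pow_iff_left₀ (norm_nonneg _) (norm_nonneg _) two_ne_zero).1 ?_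
  rw [norm_sq_eq_integral, norm_sq_eq_integral,
    ← env.integral_sum_transition P (integrable_norm_sq P f)]
  refine integral_mono_ae (integrable_norm_sq P _)
    (integrable_finsetSum _ fun y _ => env.integrable_transition P (integrable_norm_sq P f) y) ?_
  filter_upwards [env.coeFn_twistedOp P w f] with ω h
  simp only [h]
  calc ‖∑ y ∈ env.Λ, w y * (env.p ω 0 y * f (y +ᵥ ω))‖ ^ 2
      ≤ (∑ y ∈ env.Λ, env.p ω 0 y * ‖f (y +ᵥ ω)‖) ^ 2 := by
        gcongr
        refine (norm_sum_le _ _).trans (Finset.sum_le_sum fun y _ => ?_)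
        rw [norm_mul, norm_mul, Complex.norm_real, Real.norm_eq_abs,
          abs_of_nonneg (env.nonneg ω 0 y)]
        exact mul_le_of_le_one_left (mul_nonneg (env.nonneg ω 0 y) (norm_nonneg _)) (hw y)
    _ ≤ _ := Real.pow_arith_mean_le_arith_mean_pow _ _ _ (fun y _ => env.nonneg ω 0 y)
        (env.sum_row_zero ω) (fun y _ => norm_nonneg _) 2

end Invariant

variable [IsProbabilityMeasure P] [ErgodicVAdd (Zd d) Ω P]

/-- Ergodicity of the environment seen from the particle. -/
theorem ae_eq_const_of_twistedOp_one_eq (hirr : env.AlmostSurelyIrreducible P) {h : Lp ℂ 2 P}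
    (hh : env.twistedOp P 1 h = h) : ∃ c : ℂ, h = Lp.const 2 P c := by
  have hfix : ∀ᵐ ω ∂P, ∑ y ∈ env.Λ, (env.p ω 0 y : ℂ) * h (y +ᵥ ω) = h ω := by
    have h1 := env.coeFn_twistedOp P 1 h
    rw [hh] at h1
    filter_upwards [h1] with ω h2
    simpa using h2.symm
  have hsq := integrable_norm_sq P h
  have hI := integrable_finsetSum env.Λ fun y _ => env.integrable_transition P hsq y
  -- Expanding the square and using that `h` is harmonic for the cross term. By stationarity the
  -- right side has integral zero, so the nonnegative Dirichlet form on the left vanishes.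
  have hdir : ∀ᵐ ω ∂P, ∑ y ∈ env.Λ, env.p ω 0 y * ‖h (y +ᵥ ω) - h ω‖ ^ 2
      = ∑ y ∈ env.Λ, env.p ω 0 y * ‖h (y +ᵥ ω)‖ ^ 2 - ‖h ω‖ ^ 2 := by
    filter_upwards [hfix] with ω h1
    have h2 : ∀ y, env.p ω 0 y * ‖h (y +ᵥ ω) - h ω‖ ^ 2 = env.p ω 0 y * ‖h (y +ᵥ ω)‖ ^ 2
        - 2 * ((env.p ω 0 y : ℂ) * h (y +ᵥ ω) * starRingEnd ℂ (h ω)).re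
        + env.p ω 0 y * ‖h ω‖ ^ 2 := by
      intro y
      rw [← Complex.normSq_eq_norm_sq, ← Complex.normSq_eq_norm_sq, ← Complex.normSq_eq_norm_sq,
        Complex.normSq_sub, mul_assoc, Complex.re_ofReal_mul]
      ring
    simp_rw [h2]
    rw [Finset.sum_add_distrib, Finset.sum_sub_distrib, ← Finset.mul_sum, ← Complex.re_sum,
      ← Finset.sum_mul, h1, ← Finset.sum_mul, env.sum_row_zero, Complex.mul_conj,
      Complex.ofReal_re, Complex.normSq_eq_norm_sq]
    ring
  have hzero : ∀ᵐ ω ∂P, ∑ y ∈ env.Λ, env.p ω 0 y * ‖h (y +ᵥ ω) - h ω‖ ^ 2 = 0 := by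
    refine (integral_eq_zero_iff_of_nonneg_ae (.of_forall fun ω => Finset.sum_nonneg fun y _ =>
      mul_nonneg (env.nonneg ω 0 y) (by positivity)) ?_).1 ?_
    · exact (hI.sub hsq).congr (hdir.mono fun ω h1 => h1.symm)
    · rw [integral_congr_ae hdir, integral_sub hI hsq, env.integral_sum_transition P hsq, sub_self]
  have hjump : ∀ᵐ ω ∂P, ∀ y, 0 < env.p ω 0 y → h (y +ᵥ ω) = h ω := by
    filter_upwards [hzero] with ω h1 y hy
    have hyΛ : y ∈ env.Λ := by
      by_contra hcon
      exact hy.ne' (env.finite_range ω 0 y (by simpa using hcon))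
    have h2 := (Finset.sum_eq_zero_iff_of_nonneg fun y _ =>
      mul_nonneg (env.nonneg ω 0 y) (by positivity)).1 h1 y hyΛ
    simpa [hy.ne', sub_eq_zero] using h2
  -- A jump from `x` in `ω` is a jump from `0` in `x +ᵥ ω`, and there are only countably many `x`.
  have hpath : ∀ᵐ ω ∂P, ∀ x y, 0 < env.p ω x y → h (y +ᵥ ω) = h (x +ᵥ ω) := by
    rw [ae_all_iff]
    intro x
    filter_upwards [(measurePreserving_vadd x P).quasiMeasurePreserving.ae hjump] with ω h1 y hy
    have h2 := h1 (y - x) (by rw [env.equivariant]; simpa using hy)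
    rwa [vadd_vadd, sub_add_cancel] at h2
  obtain ⟨c, hc⟩ := ae_eq_const_of_forall_vadd_ae_eq P (Lp.aestronglyMeasurable h) fun z => by
    filter_upwards [hpath, hirr] with ω h1 h2
    obtain ⟨n, -, hn⟩ := h2 z
    simpa using env.eq_of_nStep_pos (h := fun z => h (z +ᵥ ω)) h1 n 0 z hn
  exact ⟨c, Lp.ext (hc.trans (Lp.coeFn_const 2 P c).symm)⟩

/-- The closure of a subspace is its double orthogonal complement. A vector orthogonal to the range
of `1 - Q` is fixed by the contraction `Q`, hence constant by ergodicity, hence orthogonal to `b`.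
-/
theorem mem_closure_range_sub_twistedOp (hirr : env.AlmostSurelyIrreducible P) {b : Lp ℂ 2 P}
    (hb : inner ℂ (Lp.const 2 P (1 : ℂ)) b = 0) :
    b ∈ closure (Set.range fun g => g - env.twistedOp P 1 g) := by
  let K : Submodule ℂ (Lp ℂ 2 P) :=
    LinearMap.range ((ContinuousLinearMap.id ℂ (Lp ℂ 2 P) - env.twistedOp P 1 :
      Lp ℂ 2 P →L[ℂ] Lp ℂ 2 P) : Lp ℂ 2 P →ₗ[ℂ] Lp ℂ 2 P)
  change b ∈ (K.topologicalClosure : Set (Lp ℂ 2 P))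
  rw [← Submodule.orthogonal_orthogonal_eq_closure, SetLike.mem_coe, Submodule.mem_orthogonal]
  intro h hh
  have h1 : inner ℂ (h - env.twistedOp P 1 h) h = 0 :=
    (Submodule.mem_orthogonal K h).1 hh _ ⟨h, rfl⟩
  have h2 : env.twistedOp P 1 h = h := by
    -- With this identity `‖Q h - h‖ ^ 2 = ‖Q h‖ ^ 2 - ‖h‖ ^ 2`, which a contraction makes
    -- nonpositive; no formula for the adjoint is needed.
    have h3 : RCLike.re (inner ℂ (env.twistedOp P 1 h) h) = ‖h‖ ^ 2 := by
      rw [inner_sub_left, sub_eq_zero] at h1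
      rw [← h1, inner_self_eq_norm_sq]
    have h4 := norm_sub_sq (𝕜 := ℂ) (env.twistedOp P 1 h) h
    have h5 : ‖env.twistedOp P 1 h‖ ≤ ‖h‖ := env.norm_twistedOp_le P (by simp) h
    have h6 : ‖env.twistedOp P 1 h‖ ^ 2 ≤ ‖h‖ ^ 2 := by gcongr
    have h7 : ‖env.twistedOp P 1 h - h‖ ^ 2 = 0 :=
      le_antisymm (by rw [h4, h3]; linarith) (by positivity)
    rwa [sq_eq_zero_iff, norm_eq_zero, sub_eq_zero] at h7
  obtain ⟨c, rfl⟩ := env.ae_eq_const_of_twistedOp_one_eq P hirr h2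
  have h3 : Lp.const 2 P c = c • Lp.const 2 P (1 : ℂ) := by
    have := (Lp.constₗ (𝕜 := ℂ) 2 P).map_smul c (1 : ℂ)
    simpa using this
  rw [h3, inner_smul_left, hb, mul_zero]

end Environment
end BistochasticRWRE

/-! ### The limit of the iterated twisted operators. -/

namespace BistochasticRWRE
namespace Environment

variable {d : ℕ} {Ω : Type*} [MeasurableSpace Ω] [AddAction (Zd d) Ω] (env : Environment d Ω)

/-- The `n`-th iterate of the transition operator twisted by `w`, applied to the constant `1`. -/
noncomputable def twistedIter (w : Zd d → ℂ) : ℕ → Ω → ℂ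
  | 0 => fun _ => 1
  | n + 1 => fun ω => ∑ y ∈ env.Λ, w y * (env.p ω 0 y * twistedIter w n (y +ᵥ ω))

section Limit

variable [MeasurableConstVAdd (Zd d) Ω] (P : Measure Ω) [IsProbabilityMeasure P]

theorem coeFn_twistedOp_pow [VAddInvariantMeasure (Zd d) Ω P] (w : Zd d → ℂ) (n : ℕ) :
    (env.twistedOp P w ^ n) (Lp.const 2 P 1) =ᵐ[P] env.twistedIter w n := by
  induction n with
  | zero => exact Lp.coeFn_const 2 P 1
  | succ n ih =>
    rw [pow_succ', mul_apply_eq_comp]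
    have h : ∀ y : Zd d, ∀ᵐ ω ∂P, (env.twistedOp P w ^ n) (Lp.const 2 P 1) (y +ᵥ ω)
        = env.twistedIter w n (y +ᵥ ω) := fun y =>
      (measurePreserving_vadd y P).quasiMeasurePreserving.ae ih
    filter_upwards [env.coeFn_twistedOp P w ((env.twistedOp P w ^ n) (Lp.const 2 P 1)),
      ae_all_iff.2 h] with ω h1 h2
    rw [h1]
    simp only [h2, twistedIter]

theorem inner_const_one (f : Lp ℂ 2 P) : inner ℂ (Lp.const 2 P (1 : ℂ)) f = ∫ ω, f ω ∂P := by
  rw [L2.inner_def]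
  exact integral_congr_ae (.of_forall fun ω => by simp)

/-- Serves twice: `w = 1`, `c = 1` expresses normalization, and a linear `w` with `c = 0` expresses
zero drift. -/
theorem sum_smul_jumpOp_const [VAddInvariantMeasure (Zd d) Ω P] {w : Zd d → ℂ} {c : ℂ}
    (hw : ∀ ω, ∑ y ∈ env.Λ, w y * env.p ω 0 y = c) :
    ∑ y ∈ env.Λ, w y • env.jumpOp P y (Lp.const 2 P 1) = c • Lp.const 2 P 1 := by
  refine Lp.ext ?_
  have h : ∀ y : Zd d, ∀ᵐ ω ∂P, (Lp.const 2 P (1 : ℂ)) (y +ᵥ ω) = 1 := fun y =>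
    (measurePreserving_vadd y P).quasiMeasurePreserving.ae (Lp.coeFn_const 2 P (1 : ℂ))
  filter_upwards [env.coeFn_sum_smul_jumpOp P w (Lp.const 2 P 1), ae_all_iff.2 h,
    Lp.coeFn_smul c (Lp.const 2 P (1 : ℂ)), Lp.coeFn_const 2 P (1 : ℂ)] with ω h1 h2 h3 h4
  rw [h1, h3, Pi.smul_apply, h4]
  simpa [h2] using hw ω

/-- The annealed central limit theorem, at the level of iterated twisted transition operators. -/
theorem tendsto_integral_twistedIter [ErgodicVAdd (Zd d) Ω P]
    (hirr : env.AlmostSurelyIrreducible P) (x : Zd d → ℝ)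
    (hx : ∀ ω, ∑ y ∈ env.Λ, x y * env.p ω 0 y = 0) :
    Tendsto (fun n : ℕ => ∫ ω, env.twistedIter
        (fun y => Complex.exp (((√(n : ℝ))⁻¹ * x y : ℝ) * Complex.I)) n ω ∂P) atTop
      (𝓝 (Complex.exp (-(∑ y ∈ env.Λ, x y ^ 2 * ∫ ω, env.p ω 0 y ∂P : ℝ) / 2))) := by
  set w : ℕ → Zd d → ℂ := fun n y => Complex.exp (((√(n : ℝ))⁻¹ * x y : ℝ) * Complex.I) with hw
  set c : ℝ := (∑ y ∈ env.Λ, x y ^ 2 * ∫ ω, env.p ω 0 y ∂P) / 2 with hc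
  set u : Lp ℂ 2 P := Lp.const 2 P (1 : ℂ) with hu
  have hw1 : ∀ n y, ‖w n y‖ ≤ 1 := fun n y => (Complex.norm_exp_ofReal_mul_I _).le
  have huu : inner ℂ u u = (1 : ℂ) := by
    rw [hu, inner_const_one, integral_congr_ae (Lp.coeFn_const 2 P (1 : ℂ))]
    simp
  have hsum1 : ∑ y ∈ env.Λ, (1 : ℂ) • env.jumpOp P y u = (1 : ℂ) • u :=
    env.sum_smul_jumpOp_const P (w := 1) fun ω => by
      simpa using congrArg ((↑) : ℝ → ℂ) (env.sum_row_zero ω)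
  have hsum0 : ∑ y ∈ env.Λ, (x y : ℂ) • env.jumpOp P y u = (0 : ℂ) • u :=
    env.sum_smul_jumpOp_const P (w := fun y => (x y : ℂ)) fun ω => by
      simpa using congrArg ((↑) : ℝ → ℂ) (hx ω)
  have hjump : ∀ y, inner ℂ u (env.jumpOp P y u) = ((∫ ω, env.p ω 0 y ∂P : ℝ) : ℂ) := fun y => by
    rw [hu, inner_const_one, ← integral_complex_ofReal]
    refine integral_congr_ae ?_
    filter_upwards [env.coeFn_jumpOp P y u,
      (measurePreserving_vadd y P).quasiMeasurePreserving.ae (Lp.coeFn_const 2 P (1 : ℂ))]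
      with ω h1 h2
    rw [h1, h2]
    simp
  have key := tendsto_pow_apply_of_mem_closure_range (env.twistedOp P 1)
    (fun n => env.twistedOp P (w n)) (fun n f => env.norm_twistedOp_le P (hw1 n) f) ?_ u
    (∑ y ∈ env.Λ, ((x y ^ 2 / 2 : ℝ) : ℂ) • env.jumpOp P y u) (c := c) ?_ ?_ ?_
  · have h1 := (tendsto_const_nhds (x := u)).inner (𝕜 := ℂ) key
    rw [inner_smul_right, huu, mul_one] at h1
    have h2 : (-(∑ y ∈ env.Λ, x y ^ 2 * ∫ ω, env.p ω 0 y ∂P : ℝ) / 2 : ℂ) = -(c : ℂ) := by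
      rw [hc]; push_cast; ring
    rw [h2]
    refine h1.congr fun n => ?_
    rw [hu, inner_const_one]
    exact integral_congr_ae (env.coeFn_twistedOp_pow P (w n) n)
  · intro g
    simp_rw [twistedOp_apply]
    refine tendsto_finsetSum _ fun y _ => Tendsto.smul_const ?_ _
    have hs : Tendsto (fun n : ℕ => (√(n : ℝ))⁻¹) atTop (𝓝 0) :=
      tendsto_inv_atTop_zero.comp (Real.tendsto_sqrt_atTop.comp tendsto_natCast_atTop_atTop)
    have hcont : Continuous fun r : ℝ => Complex.exp ((r * x y : ℝ) * Complex.I) := by fun_prop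
    simpa [hw, Function.comp_def] using (hcont.tendsto 0).comp hs
  · exact div_nonneg (Finset.sum_nonneg fun y _ => mul_nonneg (sq_nonneg _)
      (integral_nonneg fun ω => env.nonneg ω 0 y)) zero_le_two
  · have h1 : ∀ n : ℕ, (n : ℂ) • (env.twistedOp P (w n) u - u) = ∑ y ∈ env.Λ,
        ((n : ℂ) * (w n y - 1 - ((√(n : ℝ))⁻¹ * x y : ℝ) * Complex.I)) • env.jumpOp P y u := by
      intro n
      have h2 : ∀ y, (w n y - 1 - ((√(n : ℝ))⁻¹ * x y : ℝ) * Complex.I) • env.jumpOp P y u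
          = w n y • env.jumpOp P y u - (1 : ℂ) • env.jumpOp P y u
            - (((√(n : ℝ))⁻¹ : ℝ) * Complex.I : ℂ) • ((x y : ℂ) • env.jumpOp P y u) := by
        intro y
        rw [sub_smul, sub_smul, smul_smul]
        congr 2
        push_cast
        ring
      simp_rw [mul_smul]
      rw [← Finset.smul_sum, Finset.sum_congr rfl fun y _ => h2 y, Finset.sum_sub_distrib,
        Finset.sum_sub_distrib, ← Finset.smul_sum (s := env.Λ) (r := (_ * Complex.I : ℂ)), hsum0,
        hsum1,
        zero_smul, smul_zero, sub_zero, one_smul, twistedOp_apply]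
    simp_rw [h1, ← Finset.sum_neg_distrib, ← neg_smul]
    exact tendsto_finsetSum _ fun y _ =>
      (tendsto_nat_mul_exp_sub_one_sub (x y)).smul_const (env.jumpOp P y u)
  -- `c` was chosen as the mean of the quadratic term, so the difference has mean zero.
  · refine env.mem_closure_range_sub_twistedOp P hirr ?_
    rw [← hu, inner_sub_right, inner_smul_right, huu, inner_sum]
    simp_rw [inner_smul_right, hjump]
    rw [hc, mul_one, Finset.sum_div, sub_eq_zero]
    push_cast
    exact Finset.sum_congr rfl fun y _ => by ring

end Limit

end Environment
end BistochasticRWRE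

/-! ### Characteristic functions of both walks as integrals of `twistedIter`. -/

namespace BistochasticRWRE

/-- Extension by zero of a function on `[0,1)`. -/
noncomputable def zeroExtend {E : Type*} [Zero E] (f : UnitIco → E) (x : ℝ) : E :=
  open Classical in if h : x ∈ Set.Ico (0 : ℝ) 1 then f ⟨x, h⟩ else 0

theorem zeroExtend_of_mem {E : Type*} [Zero E] (f : UnitIco → E) {x : ℝ}
    (h : x ∈ Set.Ico (0 : ℝ) 1) : zeroExtend f x = f ⟨x, h⟩ := dif_pos h

theorem integral_lebesgueI {E : Type*} [NormedAddCommGroup E] [NormedSpace ℝ E]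
    (f : UnitIco → E) : ∫ s, f s ∂lebesgueI = ∫ x in (0 : ℝ)..1, zeroExtend f x := by
  rw [intervalIntegral.integral_of_le zero_le_one, ← integral_Ico_eq_integral_Ioc,
    ← integral_subtype_comap measurableSet_Ico]
  exact integral_congr_ae (.of_forall fun s => (zeroExtend_of_mem f s.2).symm)

theorem measurable_zeroExtend {E : Type*} [Zero E] [MeasurableSpace E] {f : UnitIco → E}
    (hf : Measurable f) : Measurable (zeroExtend f) := by
  classical
  unfold zeroExtend
  convert Measurable.dite (s := Set.Ico (0 : ℝ) 1) hf (measurable_const (a := (0 : E)))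
    measurableSet_Ico

namespace Environment

variable {d : ℕ} {Ω : Type*} [MeasurableSpace Ω] [AddAction (Zd d) Ω] (env : Environment d Ω)
  (e : Fin env.Λ.card ≃ env.Λ)

theorem index_eq_iff {s : UnitIco} {ω : Ω} {i : Fin env.Λ.card} :
    env.index e s ω = i ↔ s.val ∈ env.interval e ω i :=
  ⟨fun h => h ▸ env.index_spec e s ω,
    fun h => (env.existsUnique_index e ω s).unique (env.index_spec e s ω) h⟩

theorem measurable_q (i : Fin env.Λ.card) : Measurable fun ω => env.q e ω i :=
  env.measurable_p 0 _

theorem measurable_cut (k : ℕ) : Measurable fun ω => env.cut e ω k :=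
  Finset.measurable_sum _ fun i _ => env.measurable_q e i

theorem measurable_index : Measurable fun x : UnitIco × Ω => env.index e x.1 x.2 := by
  refine measurable_to_countable' fun i => ?_
  have h : (fun x : UnitIco × Ω => env.index e x.1 x.2) ⁻¹' {i} =
      {x | env.cut e x.2 i.val ≤ x.1.val} ∩ {x | x.1.val < env.cut e x.2 (i.val + 1)} := by
    ext x
    exact env.index_eq_iff e
  rw [h]
  have h1 : Measurable fun x : UnitIco × Ω => x.1.val :=
    measurable_subtype_coe.comp measurable_fst
  exact (measurableSet_le ((env.measurable_cut e _).comp measurable_snd) h1).inter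
    (measurableSet_lt h1 ((env.measurable_cut e _).comp measurable_snd))

theorem measurable_displacement : Measurable (env.displacement e) :=
  (Measurable.of_discrete (f := fun i => (e i : Zd d))).comp (env.measurable_index e)

theorem measurable_phi : Measurable (env.phi e) := by
  have hq : Measurable fun x : Fin env.Λ.card × UnitIco × Ω => env.q e x.2.2 x.1 :=
    measurable_from_prod_countable_right fun i =>
      (env.measurable_q e i).comp measurable_snd
  have hc : Measurable fun x : Fin env.Λ.card × UnitIco × Ω => env.cut e x.2.2 x.1.val :=
    measurable_from_prod_countable_right fun i =>
      (env.measurable_cut e i.val).comp measurable_snd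
  have hi := (env.measurable_index e).prodMk measurable_id
  exact ((hq.comp hi).inv.mul
    ((measurable_subtype_coe.comp measurable_fst).sub (hc.comp hi))).subtype_mk

theorem measurable_povMap [MeasurableConstVAdd (Zd d) Ω] : Measurable (env.povMap e) := by
  have h : Measurable fun x : Zd d × Ω => x.1 +ᵥ x.2 :=
    measurable_from_prod_countable_right fun z => measurable_const_vadd z
  exact (env.measurable_phi e).prodMk
    (h.comp ((env.measurable_displacement e).prodMk measurable_snd))

theorem measurable_walk [MeasurableConstVAdd (Zd d) Ω] (n : ℕ) : Measurable (env.walk e n) :=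
  Finset.measurable_sum _ fun k _ =>
    (env.measurable_displacement e).comp ((env.measurable_povMap e).iterate k)

theorem walk_succ (n : ℕ) (x : UnitIco × Ω) :
    env.walk e (n + 1) x = env.displacement e x + env.walk e n (env.povMap e x) := by
  simp only [walk, Finset.sum_range_succ', Function.iterate_succ_apply, Function.iterate_zero,
    id_eq]
  exact add_comm _ _

/-- The internal dynamics: given `ω`, the index has law `q(ω)`, and the new internal variable is
uniform and independent of it. -/
theorem integral_index_phi {E : Type*} [NormedAddCommGroup E] [NormedSpace ℝ E]
    [MeasurableSpace E] [BorelSpace E] [SecondCountableTopology E] (ω : Ω)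
    {g : Fin env.Λ.card → UnitIco → E} (hg : ∀ i, Measurable (g i)) {C : ℝ}
    (hC : ∀ i s, ‖g i s‖ ≤ C) :
    ∫ s, g (env.index e s ω) (env.phi e (s, ω)) ∂lebesgueI
      = ∑ i, env.q e ω i • ∫ s, g i s ∂lebesgueI := by
  have hF : Measurable fun s : UnitIco => g (env.index e s ω) (env.phi e (s, ω)) := by
    have h1 : Measurable fun x : Fin env.Λ.card × UnitIco => g x.1 x.2 :=
      measurable_from_prod_countable_right hg
    exact h1.comp (((env.measurable_index e).prodMk (env.measurable_phi e)).comp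
      measurable_prodMk_right)
  set F : UnitIco → E := fun s => g (env.index e s ω) (env.phi e (s, ω)) with hF_def
  have hint : ∀ a b, IntervalIntegrable (zeroExtend F) volume a b := by
    intro a b
    refine (intervalIntegrable_const (c := |C|)).mono_fun
      (measurable_zeroExtend hF).aestronglyMeasurable (.of_forall fun x => ?_)
    rw [Real.norm_eq_abs, abs_abs]
    beta_reduce
    by_cases hx : x ∈ Set.Ico (0 : ℝ) 1
    · rw [zeroExtend_of_mem F hx]
      exact (hC _ _).trans (le_abs_self C)
    · simp [zeroExtend, hx]
  have hsplit := intervalIntegral.sum_integral_adjacent_intervals (n := env.Λ.card)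
    (a := env.cut e ω) fun k _ => hint _ _
  rw [env.cut_zero, env.cut_card, Finset.sum_range] at hsplit
  rw [integral_lebesgueI, ← hsplit]
  refine Finset.sum_congr rfl fun i _ => ?_
  have hle : env.cut e ω i.val ≤ env.cut e ω (i.val + 1) := env.cut_mono e ω (Nat.le_succ _)
  have h0 : 0 ≤ env.cut e ω i.val := by
    rw [← env.cut_zero e ω]; exact env.cut_mono e ω (Nat.zero_le _)
  have h1 : env.cut e ω (i.val + 1) ≤ 1 := by
    rw [← env.cut_card e ω]; exact env.cut_mono e ω i.2
  have hq0 : 0 ≤ env.q e ω i := env.nonneg _ _ _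
  -- An empty interval `I_i` contributes zero to both sides; otherwise the affine substitution on
  -- `I_i` has Jacobian `q_i` and image `[0, 1)`.
  rcases hq0.eq_or_lt with hq | hq
  · rw [env.cut_succ, ← hq, add_zero, intervalIntegral.integral_same, zero_smul]
  · have h2 : ∫ x in (env.cut e ω i.val)..(env.cut e ω (i.val + 1)), zeroExtend F x
        = ∫ x in (env.cut e ω i.val)..(env.cut e ω (i.val + 1)),
          zeroExtend (g i) (x / env.q e ω i - env.cut e ω i.val / env.q e ω i) := by
      rw [intervalIntegral.integral_of_le hle, intervalIntegral.integral_of_le hle,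
        ← integral_Ico_eq_integral_Ioc, ← integral_Ico_eq_integral_Ioc]
      refine setIntegral_congr_fun measurableSet_Ico fun x hx => ?_
      have hx' : x ∈ Set.Ico (0 : ℝ) 1 := ⟨h0.trans hx.1, hx.2.trans_le h1⟩
      have hi : env.index e ⟨x, hx'⟩ ω = i := (env.index_eq_iff e).2 hx
      have hphi : (env.phi e (⟨x, hx'⟩, ω)).val
          = x / env.q e ω i - env.cut e ω i.val / env.q e ω i := by
        simp only [phi, hi]
        ring
      rw [zeroExtend_of_mem F hx', ← hphi, zeroExtend_of_mem (g i) (env.phi e _).2, hF_def]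
      simp only [hi]
    rw [h2, intervalIntegral.integral_comp_div_sub _ hq.ne', integral_lebesgueI, sub_self,
      env.cut_succ, add_div, div_self hq.ne', add_sub_cancel_left]

theorem sum_fin_eq_sum_jumps {E : Type*} [AddCommMonoid E] (f : Zd d → E) :
    ∑ i, f (e i) = ∑ y ∈ env.Λ, f y := by
  rw [← Finset.sum_coe_sort env.Λ]
  exact Equiv.sum_comp e fun y : env.Λ => f y

/-- By `integral_index_phi`, after the first jump the internal variable is again uniform while the
environment is translated by the jump. A character splits off this jump as a factor, so the
recursion of `twistedIter` appears. -/
theorem integral_walk [MeasurableConstVAdd (Zd d) Ω] (w : AddChar (Zd d) ℂ)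
    (hw : ∀ y, ‖w y‖ ≤ 1) (n : ℕ) (ω : Ω) :
    ∫ s, w (env.walk e n (s, ω)) ∂lebesgueI = env.twistedIter w n ω := by
  induction n generalizing ω with
  | zero => simp [walk, twistedIter]
  | succ n ih =>
    let g : Fin env.Λ.card → UnitIco → ℂ :=
      fun i s => w (e i) * w (env.walk e n (s, (e i : Zd d) +ᵥ ω))
    have h1 : ∀ s, w (env.walk e (n + 1) (s, ω)) = g (env.index e s ω) (env.phi e (s, ω)) :=
        fun s => by
      rw [walk_succ, AddChar.map_add_eq_mul]
      rfl
    rw [integral_congr_ae (.of_forall h1)]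
    refine (env.integral_index_phi e ω (g := g) (C := 1) ?_ ?_).trans ?_
    rotate_left 2
    · simp_rw [g, integral_const_mul, ih]
      rw [twistedIter]
      beta_reduce
      rw [← env.sum_fin_eq_sum_jumps e fun y => w y * (env.p ω 0 y * env.twistedIter w n (y +ᵥ ω))]
      refine Finset.sum_congr rfl fun i _ => ?_
      rw [Complex.real_smul, mul_left_comm]
      rfl
    · intro i
      exact (Measurable.of_discrete (f := w)).comp
        ((env.measurable_walk e n).comp measurable_prodMk_right) |>.const_mul _
    · intro i s
      rw [norm_mul]
      exact mul_le_one₀ (hw _) (norm_nonneg _) (hw _)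

theorem integral_povMeasure_walk [MeasurableConstVAdd (Zd d) Ω] (P : Measure Ω)
    [IsProbabilityMeasure P] (w : AddChar (Zd d) ℂ) (hw : ∀ y, ‖w y‖ ≤ 1) (n : ℕ) :
    ∫ x, w (env.walk e n x) ∂(povMeasure P) = ∫ ω, env.twistedIter w n ω ∂P := by
  have h : Integrable (fun x => w (env.walk e n x)) (lebesgueI.prod P) :=
    Integrable.of_bound ((Measurable.of_discrete (f := w)).comp
      (env.measurable_walk e n)).aestronglyMeasurable 1 (.of_forall fun x => hw _)
  rw [povMeasure, integral_prod_symm _ h]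
  simp_rw [env.integral_walk e w hw n]

theorem integrable_displacement (P : Measure Ω) [IsProbabilityMeasure P] (f : Zd d → ℝ) :
    Integrable (fun x => f (env.displacement e x)) (povMeasure P) := by
  refine Integrable.of_bound ((Measurable.of_discrete (f := f)).comp
    (env.measurable_displacement e)).aestronglyMeasurable (∑ y ∈ env.Λ, ‖f y‖)
    (.of_forall fun x => ?_)
  exact Finset.single_le_sum (f := fun y => ‖f y‖) (fun y _ => norm_nonneg _) (e _).2

theorem integral_displacement (P : Measure Ω) [IsProbabilityMeasure P] (f : Zd d → ℝ) :
    ∫ x, f (env.displacement e x) ∂(povMeasure P) = ∑ y ∈ env.Λ, f y * ∫ ω, env.p ω 0 y ∂P := by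
  have h1 : ∀ ω, ∫ s, f (env.displacement e (s, ω)) ∂lebesgueI
      = ∑ y ∈ env.Λ, f y * env.p ω 0 y := by
    intro ω
    refine (env.integral_index_phi e ω (g := fun i _ => f (e i)) (C := ∑ y ∈ env.Λ, ‖f y‖)
      (fun i => measurable_const) fun i _ => ?_).trans ?_
    · exact Finset.single_le_sum (f := fun y => ‖f y‖) (fun y _ => norm_nonneg _) (e i).2
    · rw [← env.sum_fin_eq_sum_jumps e fun y => f y * env.p ω 0 y]
      refine Finset.sum_congr rfl fun i _ => ?_
      rw [integral_const, probReal_univ, one_smul, smul_eq_mul, mul_comm]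
      rfl
  rw [povMeasure, integral_prod_symm _ (env.integrable_displacement e P f)]
  simp_rw [h1]
  rw [integral_finsetSum]
  · simp_rw [integral_const_mul]
  · intro y _
    refine Integrable.const_mul (Integrable.of_bound
      (env.measurable_p 0 y).aestronglyMeasurable 1 (.of_forall fun ω => ?_)) _
    rw [Real.norm_eq_abs, abs_of_nonneg (env.nonneg ω 0 y)]
    exact env.p_le_one ω 0 y

/-! ### The annealed walk -/

/-- The transition operator of the walk in the environment `ω`. -/
noncomputable def stepOp (ω : Ω) (f : Zd d → ℂ) (x : Zd d) : ℂ :=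
  ∑ z ∈ env.Λ, env.p ω x (x + z) * f (x + z)

theorem integral_stepKernel (ω : Ω) {f : Zd d → ℂ} {C : ℝ} (hf : ∀ x, ‖f x‖ ≤ C) (x : Zd d) :
    ∫ y, f y ∂(env.stepKernel ω x) = env.stepOp ω f x := by
  change ∫ y, f y ∂(env.stepPMF ω x).toMeasure = _
  rw [PMF.integral_eq_tsum _ _ (Integrable.of_bound
    (Measurable.of_discrete (f := f)).aestronglyMeasurable C (.of_forall hf)),
    ← (Equiv.addLeft x).tsum_eq, tsum_eq_sum (s := env.Λ)]
  · refine Finset.sum_congr rfl fun z _ => ?_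
    change (ENNReal.ofReal (env.p ω x (x + z))).toReal • f (x + z) = _
    rw [ENNReal.toReal_ofReal (env.nonneg ω _ _), Complex.real_smul]
  · intro z hz
    change (ENNReal.ofReal (env.p ω x (x + z))).toReal • f (x + z) = _
    rw [env.finite_range ω x (x + z) (by simpa using hz)]
    simp

theorem integral_quenched_zero (ω : Ω) (f : Zd d → ℂ) :
    ∫ ξ, f (ξ 0) ∂(env.quenched ω) = f 0 := by
  have h : (env.quenched ω).map (Preorder.frestrictLe 0)
      = Measure.dirac (fun _ : Finset.Iic 0 => (0 : Zd d)) := by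
    simp only [quenched, Kernel.trajMeasure]
    rw [Measure.map_comp _ _ (by fun_prop), Kernel.traj_map_frestrictLe,
      Kernel.partialTraj_self, Measure.id_comp, Measure.map_dirac]
    rfl
  calc ∫ ξ, f (ξ 0) ∂(env.quenched ω)
      = ∫ η, f (η ⟨0, by simp⟩) ∂((env.quenched ω).map
          (Preorder.frestrictLe (π := fun _ => Zd d) 0)) := by
        rw [integral_map (by fun_prop) (Measurable.of_discrete).aestronglyMeasurable]
        rfl
    _ = f 0 := by rw [h, integral_dirac]

/-- The Markov property at time `n`: the law of the path up to time `n + 1` is the law up to time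
`n` followed by the step kernel. -/
theorem integral_quenched_succ (ω : Ω) {f : Zd d → ℂ} {C : ℝ} (hf : ∀ x, ‖f x‖ ≤ C) (n : ℕ) :
    ∫ ξ, f (ξ (n + 1)) ∂(env.quenched ω) = ∫ ξ, env.stepOp ω f (ξ n) ∂(env.quenched ω) := by
  have hfm : Measurable f := .of_discrete
  calc ∫ ξ, f (ξ (n + 1)) ∂(env.quenched ω)
      = ∫ η, f η.2 ∂((env.quenched ω).map (fun ξ : ℕ → Zd d =>
          (Preorder.frestrictLe (π := fun _ => Zd d) n ξ, ξ (n + 1)))) := by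
        rw [integral_map (f := fun η : (Finset.Iic n → Zd d) × Zd d => f η.2) (by fun_prop)
          (hfm.comp measurable_snd).aestronglyMeasurable]
    _ = ∫ η, env.stepOp ω f (η ⟨n, by simp⟩) ∂((env.quenched ω).map
          (Preorder.frestrictLe (π := fun _ => Zd d) n)) := by
        rw [quenched, ← Kernel.map_frestrictLe_trajMeasure_compProd_eq_map_trajMeasure,
          Measure.integral_compProd]
        · refine integral_congr_ae (.of_forall fun η => ?_)
          exact env.integral_stepKernel ω hf _
        · exact Integrable.of_bound (hfm.comp measurable_snd).aestronglyMeasurable C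
            (.of_forall fun η => hf _)
    _ = _ := by
        rw [integral_map (by fun_prop) (Measurable.of_discrete).aestronglyMeasurable]
        rfl

theorem norm_stepOp_le (ω : Ω) {f : Zd d → ℂ} {C : ℝ} (hf : ∀ x, ‖f x‖ ≤ C) (x : Zd d) :
    ‖env.stepOp ω f x‖ ≤ C := by
  rw [← env.integral_stepKernel ω hf]
  refine (norm_integral_le_of_norm_le_const (.of_forall hf)).trans_eq ?_
  rw [probReal_univ, mul_one]

theorem integral_quenched (ω : Ω) {f : Zd d → ℂ} {C : ℝ} (hf : ∀ x, ‖f x‖ ≤ C) (n : ℕ) :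
    ∫ ξ, f (ξ n) ∂(env.quenched ω) = (env.stepOp ω)^[n] f 0 := by
  induction n generalizing f with
  | zero => exact env.integral_quenched_zero ω f
  | succ n ih => rw [env.integral_quenched_succ ω hf, ih (env.norm_stepOp_le ω hf),
      Function.iterate_succ_apply]

/-- By equivariance, walking from `x` in `ω` is walking from `0` in `x +ᵥ ω`; a character turns the
displaced starting point into the factor `w x`. -/
theorem stepOp_iterate (ω : Ω) (w : AddChar (Zd d) ℂ) (n : ℕ) (x : Zd d) :
    (env.stepOp ω)^[n] w x = w x * env.twistedIter w n (x +ᵥ ω) := by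
  induction n generalizing x with
  | zero => simp [twistedIter]
  | succ n ih =>
    rw [Function.iterate_succ_apply', stepOp, twistedIter, Finset.mul_sum]
    refine Finset.sum_congr rfl fun z _ => ?_
    rw [ih, env.equivariant, zero_add, AddChar.map_add_eq_mul, vadd_vadd, add_comm z x]
    ring

theorem integral_annealed (P : Measure Ω) [IsProbabilityMeasure P] (w : AddChar (Zd d) ℂ)
    (hw : ∀ y, ‖w y‖ ≤ 1) (n : ℕ) :
    ∫ ξ, w (ξ.2 n) ∂(env.annealed P) = ∫ ω, env.twistedIter w n ω ∂P := by
  have hm : Measurable fun ξ : Ω × (ℕ → Zd d) => w (ξ.2 n) :=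
    (Measurable.of_discrete (f := w)).comp ((measurable_pi_apply n).comp measurable_snd)
  rw [annealed, Measure.integral_compProd (Integrable.of_bound hm.aestronglyMeasurable 1
    (.of_forall fun ξ => hw _))]
  refine integral_congr_ae (.of_forall fun ω => ?_)
  refine (env.integral_quenched ω hw n).trans ?_
  rw [stepOp_iterate, zero_vadd, AddChar.map_zero_eq_one, one_mul]

end Environment
end BistochasticRWRE

/-! ### Lévy's continuity theorem, the covariance matrix, and the conclusion. -/

namespace BistochasticRWRE

theorem inner_toEuclid {d : ℕ} (y : Zd d) (t : EuclideanSpace ℝ (Fin d)) :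
    inner ℝ (toEuclid y) t = ∑ α, (y α : ℝ) * t α := by
  rw [EuclideanSpace.inner_eq_star_dotProduct]
  simp [dotProduct, toEuclid, mul_comm]

/-- The character `y ↦ exp(i r ⟨y, t⟩)` of `ℤ^d`. -/
noncomputable def expChar {d : ℕ} (t : EuclideanSpace ℝ (Fin d)) (r : ℝ) : AddChar (Zd d) ℂ where
  toFun y := Complex.exp ((r * inner ℝ (toEuclid y) t : ℝ) * Complex.I)
  map_zero_eq_one' := by simp [inner_toEuclid]
  map_add_eq_mul' x y := by
    rw [← Complex.exp_add, ← add_mul, ← Complex.ofReal_add, ← mul_add]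
    simp [inner_toEuclid, add_mul, Finset.sum_add_distrib]

theorem expChar_apply {d : ℕ} (t : EuclideanSpace ℝ (Fin d)) (r : ℝ) (y : Zd d) :
    expChar t r y = Complex.exp ((r * inner ℝ (toEuclid y) t : ℝ) * Complex.I) := rfl

theorem norm_expChar {d : ℕ} (t : EuclideanSpace ℝ (Fin d)) (r : ℝ) (y : Zd d) :
    ‖expChar t r y‖ = 1 := Complex.norm_exp_ofReal_mul_I _

/-- Lévy's continuity theorem, with the characteristic function of `X n / √n` at `t` written as the
integral of a lattice character. -/
theorem satisfiesCLT_of_tendsto_integral {d : ℕ} {S : Type*} [MeasurableSpace S]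
    {X : ℕ → S → Zd d} (hX : ∀ n, Measurable (X n)) (μ : Measure S) [IsProbabilityMeasure μ]
    {C : Matrix (Fin d) (Fin d) ℝ} (hC : C.PosSemidef)
    (h : ∀ t : EuclideanSpace ℝ (Fin d), Tendsto
      (fun n : ℕ => ∫ s, expChar t (√(n : ℝ))⁻¹ (X n s) ∂μ) atTop
      (𝓝 (Complex.exp (-(t.ofLp ⬝ᵥ C.mulVec t.ofLp : ℝ) / 2)))) :
    SatisfiesCLT X μ C := by
  have hm : ∀ n : ℕ, Measurable fun s => (√(n : ℝ))⁻¹ • toEuclid (X n s) := fun n =>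
    (Measurable.of_discrete (f := fun y : Zd d => (√(n : ℝ))⁻¹ • toEuclid y)).comp (hX n)
  refine ⟨hC, fun n => (hm n).aemeasurable, aemeasurable_id,
    ProbabilityMeasure.tendsto_iff_tendsto_charFun.2 fun t => ?_⟩
  simp only [ProbabilityMeasure.coe_mk, Measure.map_id]
  rw [charFun_multivariateGaussian hC]
  convert h t using 2 with n
  · rw [charFun_apply, integral_map (hm n).aemeasurable (by fun_prop)]
    simp_rw [expChar_apply, real_inner_smul_left]
  · simp [neg_div]

namespace Environment

variable {d : ℕ} {Ω : Type*} [MeasurableSpace Ω] [AddAction (Zd d) Ω] (env : Environment d Ω)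
  (e : Fin env.Λ.card ≃ env.Λ)

theorem sum_inner_mul_p (t : EuclideanSpace ℝ (Fin d)) (ω : Ω) :
    ∑ y ∈ env.Λ, inner ℝ (toEuclid y) t * env.p ω 0 y = 0 := by
  have h : ∑ y ∈ env.Λ, env.p ω 0 y • toEuclid y = 0 := by
    refine (hasSum_sum_of_ne_finset_zero fun y hy => ?_).unique
      (by simpa using env.zero_drift ω 0)
    rw [env.finite_range ω 0 y (by simpa using hy), zero_smul]
  have h1 := congrArg (fun v => inner ℝ v t) h
  simpa [sum_inner, real_inner_smul_left, mul_comm] using h1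

/-- Identifies the variance produced by the operator limit with the quadratic form of `C`; as a sum
of nonnegative terms it also gives positive semidefiniteness. -/
theorem dotProduct_covMatrix_mulVec (P : Measure Ω) [IsProbabilityMeasure P]
    (t : EuclideanSpace ℝ (Fin d)) :
    t.ofLp ⬝ᵥ (env.covMatrix e P).mulVec t.ofLp
      = ∑ y ∈ env.Λ, inner ℝ (toEuclid y) t ^ 2 * ∫ ω, env.p ω 0 y ∂P := by
  have h1 : ∀ α β, env.covMatrix e P α β
      = ∑ y ∈ env.Λ, (y α : ℝ) * (y β : ℝ) * ∫ ω, env.p ω 0 y ∂P := fun α β =>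
    env.integral_displacement e P fun y => (y α : ℝ) * (y β : ℝ)
  simp only [dotProduct, Matrix.mulVec, h1, inner_toEuclid, sq,
    Finset.sum_mul, Finset.mul_sum]
  rw [Finset.sum_comm (s := env.Λ)]
  refine Finset.sum_congr rfl fun α _ => ?_
  rw [Finset.sum_comm (s := env.Λ)]
  refine Finset.sum_congr rfl fun β _ => Finset.sum_congr rfl fun y _ => ?_
  ring

theorem posSemidef_covMatrix (P : Measure Ω) [IsProbabilityMeasure P] :
    (env.covMatrix e P).PosSemidef := by
  refine Matrix.PosSemidef.of_dotProduct_mulVec_nonneg ?_ fun x => ?_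
  · ext α β
    simp [covMatrix, mul_comm]
  · have h := env.dotProduct_covMatrix_mulVec e P (WithLp.toLp 2 x)
    simp only [star_trivial] at h ⊢
    rw [h]
    exact Finset.sum_nonneg fun y _ => mul_nonneg (sq_nonneg _)
      (integral_nonneg fun ω => env.nonneg ω 0 y)

theorem tendsto_integral_twistedIter_expChar [MeasurableConstVAdd (Zd d) Ω] (P : Measure Ω)
    [IsProbabilityMeasure P] [ErgodicVAdd (Zd d) Ω P] (hirr : env.AlmostSurelyIrreducible P)
    (t : EuclideanSpace ℝ (Fin d)) :
    Tendsto (fun n : ℕ => ∫ ω, env.twistedIter (expChar t (√(n : ℝ))⁻¹) n ω ∂P) atTop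
      (𝓝 (Complex.exp (-(t.ofLp ⬝ᵥ (env.covMatrix e P).mulVec t.ofLp : ℝ) / 2))) := by
  rw [dotProduct_covMatrix_mulVec]
  exact env.tendsto_integral_twistedIter P hirr (fun y => inner ℝ (toEuclid y) t)
    (env.sum_inner_mul_p t)

end Environment
end BistochasticRWRE

open BistochasticRWRE
theorem mainTheorem1 {d : ℕ} {Ω : Type*} [MeasurableSpace Ω] [AddAction (Zd d) Ω]
    [MeasurableConstVAdd (Zd d) Ω] (P : Measure Ω) [IsProbabilityMeasure P]
    [ErgodicVAdd (Zd d) Ω P] (env : Environment d Ω) (hirr : env.AlmostSurelyIrreducible P)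
    (e : Fin env.Λ.card ≃ env.Λ) :
    (∀ α β, Integrable
      (fun x => (env.displacement e x α : ℝ) * (env.displacement e x β : ℝ)) (povMeasure P)) ∧
    SatisfiesCLT (env.walk e) (povMeasure P) (env.covMatrix e P) ∧
    SatisfiesCLT (fun n (ξ : Ω × (ℕ → Zd d)) => ξ.2 n) (env.annealed P) (env.covMatrix e P) := by
  have hlim := env.tendsto_integral_twistedIter_expChar e P hirr
  refine ⟨fun α β => env.integrable_displacement e P fun y => (y α : ℝ) * (y β : ℝ),
    satisfiesCLT_of_tendsto_integral (env.measurable_walk e) _ (env.posSemidef_covMatrix e P)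
      fun t => (hlim t).congr fun n => ?_,
    satisfiesCLT_of_tendsto_integral (fun n => (measurable_pi_apply n).comp measurable_snd) _
      (env.posSemidef_covMatrix e P) fun t => (hlim t).congr fun n => ?_⟩
  · exact (env.integral_povMeasure_walk e P _ (fun y => (norm_expChar t _ y).le) n).symm
  · exact (env.integral_annealed P _ (fun y => (norm_expChar t _ y).le) n).symm
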